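/- Let $A$ be a $C^*$-algebra of compact operators, i.e. a $C^*$-algebra that is (isomorphic to) a $C^*$-subalgebra of the algebra $K(H)$ of compact operators on a Hilbert space $H$. A *pre-Hilbert $A$-module* is a complex vector space and right $A$-module $U$ with a map $(\cdot,\cdot)_U:U\times U\to A$ such that $(u,zv+w)=z(u,v)+(u,w)$, $(u,v\cdot a)=(u,v)a$, $(u,v)=(v,u)^*$, $(u,u)\ge 0$, and $(u,u)=0$ only if $u=0$, for $u,v,w\in U$, $z\in\mathbb C$, $a\in A$. It is normed by $|u|_U=\sqrt{|(u,u)|_A}$, and it is a *Hilbert $A$-module* if it is complete. A *morphism* $F:U\to V$ of (pre-)Hilbert $A$-modules is a continuous $A$-linear map that has an adjoint, i.e. a map $F^*:V\to U$ with $(Fu,v)_V=(u,F^*v)_U$ for all $u\in U$, $v\in V$; an endomorphism $F$ is *self-adjoint* if $F^*=F$. For Hilbert $A$-modules $U,V$, a morphism $U\to V$ is of *$A$-finite rank* if it is a finite sum of elementary operators $u'\mapsto v\cdot(u,u')$ with $u\in U$, $v\in V$; it is *$A$-compact* if it is a limit in operator norm of morphisms of $A$-finite rank. A morphism $F:U\to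 V$ of Hilbert $A$-modules is *$A$-Fredholm* if there are morphisms $G_1,G_2:V\to U$ and $A$-compact morphisms $P_U:U\to U$, $P_V:V\to V$ with $G_1F=1_U+P_U$ and $FG_2=1_V+P_V$. A morphism $F:U\to U$ of a pre-Hilbert $A$-module is *self-adjoint parametrix possessing* if $F$ is self-adjoint and there are a morphism $G:U\to U$ and a self-adjoint morphism $P:U\to U$ with $1_U=GF+P$, $1_U=FG+P$ and $FP=0$. **Theorem 6.** Let $V$ and $W$ be Hilbert $A$-modules and let $U$ be a pre-Hilbert $A$-module which is a vector subspace of $V$ and of $W$, such that $|u|_W=|u|_U$ for all $u\in U$ and the norm $|\cdot|_V$ restricted to $U$ dominates $|\cdot|_U$ (there is a constant $C$ with $|u|_U\le C|u|_V$ for all $u\in U$). Let $D:U\to U$ be a self-adjoint morphism of pre-Hilbert $A$-modules which has an extension to a morphism $\widetilde D:V\to W$ of Hilbert $A$-modules (continuous, $A$-linear, adjointable) such that 1. $\widetilde D$ is $A$-Fredholm, 2. $\widetilde D^{-1}(U)\subseteq U$ and $(\widetilde D^{*})^{-1}(U)\subseteq U$ (preimages), and 3. $\operatorname{Ker}\widetilde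 D\subseteq U$ and $\operatorname{Ker}\widetilde D^{*}\subseteq U$. Then $D$ is a self-adjoint parametrix possessing operator on $U$. -/

import Mathlib

universe uA uH

/- Conventions.  For a C*-algebra `A`, a pre-Hilbert (right) `A`-module is a type `U` with
`[NormedAddCommGroup U] [NormedSpace ℂ U] [SMul Aᵐᵒᵖ U] [CStarModule Aᵐᵒᵖ U]`: the right action is
`u <• a = MulOpposite.op a • u`, and the `A`-product is `(u, v) = unop (inner Aᵐᵒᵖ u v)`, with
`(u, v <• a) = (u, v) a`, `(u, v)^* = (v, u)`, `0 ≤ (u, u)`, and `(u, u) = 0` only for `u = 0`.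
The norm is part of `CStarModule`: `‖u‖ = √‖(u, u)‖`.  The remaining laws of a right `A`-module
(biadditivity, associativity, compatibility with the complex scalars) follow from these, since the
`A`-product separates points.  A Hilbert `A`-module satisfies `[CompleteSpace U]` in addition. -/

/-- A C*-algebra of compact operators: a C*-algebra which is (up to isomorphism) a C*-subalgebra of
the compact operators on a Hilbert space `H`.  (An injective star homomorphism between C*-algebras
is isometric and has a closed range.) -/
def IsCStarAlgebraOfCompactOperators (A : Type uA) [NonUnitalCStarAlgebra A] : Prop :=
  ∃ (H : Type uH) (_ : NormedAddCommGroup H) (_ : InnerProductSpace ℂ H) (_ : CompleteSpace H)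
    (π : A →⋆ₙₐ[ℂ] (H →L[ℂ] H)), Function.Injective π ∧ ∀ a : A, IsCompactOperator (π a)

section Morphisms

open scoped RightActions

variable (A : Type*) [NonUnitalCStarAlgebra A] [PartialOrder A] [StarOrderedRing A]
variable {U : Type*} [NormedAddCommGroup U] [NormedSpace ℂ U] [SMul Aᵐᵒᵖ U] [CStarModule Aᵐᵒᵖ U]
variable {V : Type*} [NormedAddCommGroup V] [NormedSpace ℂ V] [SMul Aᵐᵒᵖ V] [CStarModule Aᵐᵒᵖ V]

/-- `G : V → U` is the adjoint of `F : U → V`, that is, `(F u, v) = (u, G v)` for all `u`, `v`.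
(There is at most one such `G`.) -/
def IsAdjointMap (F : U → V) (G : V → U) : Prop :=
  ∀ (u : U) (v : V), inner Aᵐᵒᵖ (F u) v = inner Aᵐᵒᵖ u (G v)

/-- A morphism of (pre-)Hilbert `A`-modules: a continuous, `A`-linear and adjointable map. -/
def IsModuleMorphism (F : U →L[ℂ] V) : Prop :=
  (∀ (u : U) (a : A), F (u <• a) = F u <• a) ∧ ∃ G : V → U, IsAdjointMap A F G

/-- A morphism is of `A`-finite rank if it is a finite sum of elementary operators
`F_{x,y} : u ↦ y · (x, u)`.  (The elementary operators are stable under the action of `A` and under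
complex scalars on `y`.) -/
def IsAFiniteRank (F : U →L[ℂ] V) : Prop :=
  IsModuleMorphism A F ∧
    ∃ (n : ℕ) (x : Fin n → U) (y : Fin n → V),
      ∀ u : U, F u = ∑ i, y i <• (inner Aᵐᵒᵖ (x i) u).unop

/-- The `A`-compact operators: the closure, in the operator norm, of the `A`-finite rank morphisms
within the space of all morphisms. -/
def IsACompact (F : U →L[ℂ] V) : Prop :=
  IsModuleMorphism A F ∧ F ∈ closure {T : U →L[ℂ] V | IsAFiniteRank A T}

/-- A morphism is `A`-Fredholm if it is left and right invertible modulo `A`-compact operators. -/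
def IsAFredholm (F : U →L[ℂ] V) : Prop :=
  IsModuleMorphism A F ∧
  (∃ (G : V →L[ℂ] U) (P : U →L[ℂ] U), IsModuleMorphism A G ∧ IsACompact A P ∧
    G ∘L F = ContinuousLinearMap.id ℂ U + P) ∧
  (∃ (G : V →L[ℂ] U) (P : V →L[ℂ] V), IsModuleMorphism A G ∧ IsACompact A P ∧
    F ∘L G = ContinuousLinearMap.id ℂ V + P)

/-- A self-adjoint parametrix possessing endomorphism `F` of a pre-Hilbert `A`-module `U`: `F` is a
self-adjoint morphism, and there are a morphism `G` and a self-adjoint morphism `P` with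
`1 = GF + P`, `1 = FG + P` and `FP = 0`. -/
def IsSelfAdjointParametrixPossessing (F : U →L[ℂ] U) : Prop :=
  IsModuleMorphism A F ∧ IsAdjointMap A F F ∧
  ∃ G P : U →L[ℂ] U, IsModuleMorphism A G ∧ IsModuleMorphism A P ∧ IsAdjointMap A P P ∧
    ContinuousLinearMap.id ℂ U = G ∘L F + P ∧
    ContinuousLinearMap.id ℂ U = F ∘L G + P ∧
    F ∘L P = 0

end Morphisms

/-! In a Hilbert module closed submodules need not be complemented, so the splitting `W = Ker Dt* ⊕
Ran Dt` has to be earned. The key estimate is that the adjoint is bounded below on the closure of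
the range. Otherwise there are unit vectors `w k` in that closure with `Dt* (w k) → 0`. They are
asymptotically orthogonal, since a fixed `w m` is nearly in the range. The right parametrix
nevertheless gives `(w k, w l) ≈ (w k, Q² (w l))` with `Q` of finite rank. Representing `A` by
compact operators, `Q²` makes these products nearly independent of `l` along a subsequence, so the
diagonal products would be small too.

Given the estimate, `Dt Dt*` is invertible on the closed range: it is self-adjoint and bounded
below, and a continuity argument along imaginary shifts replaces the spectral theorem. This yields
the splitting and a bounded choice of preimages. The regularity hypotheses bring both down to `U`.

The embedding of `U` in `W` is only assumed to preserve norms, not `A`-products, so orthogonality in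
`W` must be carried to `U` by a norm inequality; this is
`IsAdjointMap.apply_eq_zero_of_norm_smul_le`. On `U`, `P` is then the projection onto `Ker D`, and
`G` inverts `D` on its range and vanishes on its kernel. -/

/-- An operator `T` on a complex Banach space such that all `T + i t`, `t` real, are bounded below by
a common constant is invertible. -/
theorem ContinuousLinearMap.isUnit_of_forall_bounded_below {E : Type*} [NormedAddCommGroup E]
    [NormedSpace ℂ E] [CompleteSpace E] (T : E →L[ℂ] E) {c : ℝ} (hc : 0 < c)
    (hT : ∀ (t : ℝ) (y : E), c * ‖y‖ ≤ ‖T y + ((t : ℂ) * Complex.I) • y‖) : IsUnit T := by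
  rcases subsingleton_or_nontrivial E with hs | hn
  · have : T = 1 := by ext y; exact Subsingleton.elim _ _
    rw [this]
    exact isUnit_one
  let R : ℝ → (E →L[ℂ] E) := fun t => T + ((t : ℂ) * Complex.I) • 1
  -- The inverse of `R s` has norm at most `c⁻¹`, so invertibility spreads over every distance below
  -- `c`. As `c` is uniform, finitely many steps of `c / 2` lead from a large `t`, outside the
  -- spectrum, down to `0`.
  have step : ∀ s t : ℝ, |t - s| < c → IsUnit (R s) → IsUnit (R t) := by
    rintro s t hst ⟨u, hu⟩
    refine ⟨u.ofNearby (R t) ?_, rfl⟩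
    have hinv : ‖(↑u⁻¹ : E →L[ℂ] E)‖ ≤ c⁻¹ := by
      refine ContinuousLinearMap.opNorm_le_bound _ (by positivity) fun y => ?_
      have h1 : c * ‖(↑u⁻¹ : E →L[ℂ] E) y‖ ≤ ‖R s ((↑u⁻¹ : E →L[ℂ] E) y)‖ := hT s _
      have h2 : R s ((↑u⁻¹ : E →L[ℂ] E) y) = y := by
        rw [← hu]
        exact congrArg (fun f : E →L[ℂ] E => f y) u.mul_inv
      rw [h2] at h1
      rw [inv_mul_eq_div, le_div_iff₀ hc]
      linarith
    have hpos : 0 < ‖(↑u⁻¹ : E →L[ℂ] E)‖ := Units.norm_pos u⁻¹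
    have hd : R t - ↑u = (((t - s : ℝ) : ℂ) * Complex.I) • (1 : E →L[ℂ] E) := by
      rw [hu]
      simp only [R, Complex.ofReal_sub, sub_mul, sub_smul]
      abel
    calc ‖R t - ↑u‖ = |t - s| := by
          rw [hd, norm_smul, norm_mul, Complex.norm_I, Complex.norm_real, norm_one, mul_one,
            mul_one, Real.norm_eq_abs]
      _ < c := hst
      _ ≤ ‖(↑u⁻¹ : E →L[ℂ] E)‖⁻¹ := (le_inv_comm₀ hc hpos).mpr hinv
  have large : IsUnit (R (‖T‖ + 1)) := by
    have h : -(((‖T‖ + 1 : ℝ) : ℂ) * Complex.I) ∉ spectrum ℂ T := by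
      intro hmem
      have h1 := spectrum.norm_le_norm_of_mem hmem
      rw [norm_neg, norm_mul, Complex.norm_I, mul_one, Complex.norm_real,
        Real.norm_of_nonneg (by positivity)] at h1
      linarith
    rw [spectrum.notMem_iff, Algebra.algebraMap_eq_smul_one] at h
    convert h.neg using 1
    simp only [R]
    rw [neg_sub, neg_smul, sub_neg_eq_add]
  have down : ∀ n : ℕ, ∀ t : ℝ, t ≤ ‖T‖ + 1 → ‖T‖ + 1 - t ≤ n * (c / 2) → IsUnit (R t) := by
    intro n
    induction n with
    | zero =>
      intro t h ht
      have : t = ‖T‖ + 1 := by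
        simp only [Nat.cast_zero, zero_mul] at ht
        linarith
      rwa [this]
    | succ n ih =>
      intro t h ht
      push_cast at ht
      refine step (min (t + c / 2) (‖T‖ + 1)) t ?_ (ih _ (min_le_right _ _) ?_)
      · rw [abs_lt]
        rcases min_cases (t + c / 2) (‖T‖ + 1) with h' | h' <;> constructor <;> linarith
      · have : (0 : ℝ) ≤ n * (c / 2) := by positivity
        rcases min_cases (t + c / 2) (‖T‖ + 1) with h' | h' <;> linarith
  obtain ⟨n, hn⟩ := exists_nat_ge ((‖T‖ + 1 - 0) / (c / 2))
  have h0 := down n 0 (by positivity) ((div_le_iff₀ (by positivity)).mp hn)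
  have hT0 : R 0 = T := by simp [R]
  rwa [hT0] at h0

/-! ### Adjointable maps and self-adjoint operators bounded below -/

section AdjointMaps

open scoped RightActions
open CStarModule (inner_self inner_self_nonneg star_inner norm_sq_eq norm_inner_le
  inner_smul_right_complex inner_smul_left_complex)

variable {A : Type*} [NonUnitalCStarAlgebra A] [PartialOrder A]
variable {U : Type*} [NormedAddCommGroup U] [NormedSpace ℂ U] [SMul Aᵐᵒᵖ U] [CStarModule Aᵐᵒᵖ U]
variable {V : Type*} [NormedAddCommGroup V] [NormedSpace ℂ V] [SMul Aᵐᵒᵖ V] [CStarModule Aᵐᵒᵖ V]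

local notation "⟪" x ", " y "⟫" => inner Aᵐᵒᵖ x y

variable (A) in
theorem eq_of_forall_inner_eq {x y : U} (h : ∀ z : U, ⟪z, x⟫ = ⟪z, y⟫) : x = y := by
  have : ⟪x - y, x - y⟫ = 0 := by rw [CStarModule.inner_sub_right, h, sub_self]
  exact sub_eq_zero.mp (inner_self.mp this)

theorem IsAdjointMap.symm {F : U → V} {G : V → U} (h : IsAdjointMap A F G) :
    IsAdjointMap A G F := fun v u => by
  rw [← star_inner, ← h, star_inner]

/-- Adjointability alone forces linearity, because the `A`-product separates points. Maps built from
arbitrary choices therefore become linear as soon as an adjoint is found. -/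
theorem IsAdjointMap.map_add {F : U → V} {G : V → U} (h : IsAdjointMap A F G) (x y : U) :
    F (x + y) = F x + F y :=
  eq_of_forall_inner_eq A fun z => by simp [← h.symm z]

theorem IsAdjointMap.map_complex_smul {F : U → V} {G : V → U} (h : IsAdjointMap A F G) (c : ℂ)
    (x : U) : F (c • x) = c • F x :=
  eq_of_forall_inner_eq A fun z => by simp [← h.symm z]

theorem IsAdjointMap.map_right_smul {F : U → V} {G : V → U} (h : IsAdjointMap A F G) (u : U)
    (a : A) : F (u <• a) = F u <• a :=
  eq_of_forall_inner_eq A fun z => by simp [← h.symm z]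

theorem IsAdjointMap.isModuleMorphism {F : U →L[ℂ] V} {G : V → U} (h : IsAdjointMap A F G) :
    IsModuleMorphism A F :=
  ⟨h.map_right_smul, G, h⟩

theorem IsAdjointMap.exists_continuousLinearMap_of_norm_le {F : U → V} {G : V → U}
    (h : IsAdjointMap A F G) {C : ℝ} (hC : ∀ u, ‖F u‖ ≤ C * ‖u‖) :
    ∃ F' : U →L[ℂ] V, ⇑F' = F := by
  let f : U →ₗ[ℂ] V :=
    { toFun := F
      map_add' := h.map_add
      map_smul' := h.map_complex_smul }
  exact ⟨f.mkContinuous C hC, rfl⟩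

variable [StarOrderedRing A]

/-- An adjoint of a bounded operator is a bounded operator. -/
theorem IsAdjointMap.exists_continuousLinearMap {F : U →L[ℂ] V} {G : V → U}
    (h : IsAdjointMap A F G) : ∃ G' : V →L[ℂ] U, ⇑G' = G := by
  refine h.symm.exists_continuousLinearMap_of_norm_le (C := ‖F‖) fun v => ?_
  rcases (norm_nonneg (G v)).eq_or_lt with h0 | h0
  · rw [← h0]; positivity
  refine le_of_mul_le_mul_right ?_ h0
  calc ‖G v‖ * ‖G v‖ = ‖⟪G v, G v⟫‖ := by rw [← norm_sq_eq Aᵐᵒᵖ, sq]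
    _ = ‖⟪F (G v), v⟫‖ := by rw [h]
    _ ≤ ‖F (G v)‖ * ‖v‖ := norm_inner_le V
    _ ≤ ‖F‖ * ‖G v‖ * ‖v‖ := by gcongr; exact F.le_opNorm _
    _ = ‖F‖ * ‖v‖ * ‖G v‖ := by ring

theorem norm_le_of_inner_self_le {x : U} {y : V} (h : ⟪x, x⟫ ≤ ⟪y, y⟫) : ‖x‖ ≤ ‖y‖ := by
  refine le_of_sq_le_sq ?_ (norm_nonneg y)
  rw [norm_sq_eq Aᵐᵒᵖ, norm_sq_eq Aᵐᵒᵖ]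
  exact CStarAlgebra.norm_le_norm_of_nonneg_of_le inner_self_nonneg h

variable (A) in
theorem norm_le_norm_add_of_inner_eq_zero {x y : U} (h : ⟪x, y⟫ = 0) : ‖y‖ ≤ ‖x + y‖ := by
  have h' : ⟪y, x⟫ = 0 := by rw [← star_inner, h, star_zero]
  refine norm_le_of_inner_self_le (A := A) ?_
  simp only [CStarModule.inner_add_left, CStarModule.inner_add_right, h, h', add_zero, zero_add]
  exact le_add_of_nonneg_left inner_self_nonneg

/-- A self-adjoint operator that is bounded below on an invariant complete subspace maps that
subspace onto itself. -/
theorem IsAdjointMap.exists_apply_eq_of_bounded_below {S : U →L[ℂ] U} (hS : IsAdjointMap A S S)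
    (Y : Submodule ℂ U) [CompleteSpace Y] (hY : ∀ y ∈ Y, S y ∈ Y) {c : ℝ} (hc : 0 < c)
    (hb : ∀ y ∈ Y, c * ‖y‖ ≤ ‖S y‖) : ∀ y ∈ Y, ∃ x ∈ Y, S x = y := by
  let T : Y →L[ℂ] Y := (S.comp Y.subtypeL).codRestrict Y fun y => hY y y.2
  have hR : ∀ (t : ℝ) (y : Y), c * ‖y‖ ≤ ‖T y + ((t : ℂ) * Complex.I) • y‖ := by
    rintro t ⟨y, hy⟩
    refine (hb y hy).trans ?_
    change ‖S y‖ ≤ ‖S y + ((t : ℂ) * Complex.I) • y‖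
    refine norm_le_of_inner_self_le (A := A) ?_
    have h1 : ⟪S y, y⟫ = ⟪y, S y⟫ := hS _ _
    have h2 : (0 : Aᵐᵒᵖ) ≤ (t ^ 2 : ℝ) • ⟪y, y⟫ := smul_nonneg (by positivity) inner_self_nonneg
    have h3 : (star ((t : ℂ) * Complex.I)) * ((t : ℂ) * Complex.I) = ((t ^ 2 : ℝ) : ℂ) := by
      simp only [star_mul', RCLike.star_def, Complex.conj_ofReal, Complex.conj_I]
      push_cast
      linear_combination -(t : ℂ) ^ 2 * Complex.I_sq
    have h4 : star ((t : ℂ) * Complex.I) = -((t : ℂ) * Complex.I) := by simp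
    -- Self-adjointness cancels the cross terms, so an imaginary shift can only increase the
    -- `A`-valued square.
    have h5 : ⟪S y + ((t : ℂ) * Complex.I) • y, S y + ((t : ℂ) * Complex.I) • y⟫
        = ⟪S y, S y⟫ + (t ^ 2 : ℝ) • ⟪y, y⟫ := by
      rw [CStarModule.inner_add_left, CStarModule.inner_add_right, CStarModule.inner_add_right,
        inner_smul_right_complex, inner_smul_left_complex, inner_smul_left_complex,
        inner_smul_right_complex, smul_smul, h4, h1, ← Complex.coe_smul, ← h3, h4, neg_smul,
        mul_comm]
      abel
    rw [h5]
    exact le_add_of_nonneg_right h2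
  obtain ⟨u, hu⟩ := T.isUnit_of_forall_bounded_below hc hR
  intro y hy
  refine ⟨(↑u⁻¹ : Y →L[ℂ] Y) ⟨y, hy⟩, Subtype.mem _, ?_⟩
  have h1 : (T * (↑u⁻¹ : Y →L[ℂ] Y)) ⟨y, hy⟩ = ⟨y, hy⟩ := by
    rw [← hu, u.mul_inv]
    rfl
  exact congrArg Subtype.val h1

end AdjointMaps

/-! ### The lower bound from compactness -/

section Compactness

open Filter
open scoped RightActions

/-- Finitely many compact operators applied to bounded sequences give convergent sequences along a
common subsequence. -/
theorem exists_strictMono_forall_tendsto {ι H K : Type*} [Finite ι]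
    [NormedAddCommGroup H] [NormedSpace ℂ H] [NormedAddCommGroup K] [NormedSpace ℂ K]
    {T : ι → H →L[ℂ] K} (hT : ∀ i, IsCompactOperator (T i)) {ξ : ι → ℕ → H} {r : ℝ}
    (hξ : ∀ i k, ‖ξ i k‖ ≤ r) :
    ∃ φ : ℕ → ℕ, StrictMono φ ∧ ∃ a : ι → K,
      ∀ i, Tendsto (fun k => T i (ξ i (φ k))) atTop (nhds (a i)) := by
  have hcomp : IsCompact (Set.univ.pi fun i => closure (T i '' Metric.closedBall 0 r)) :=
    isCompact_univ_pi fun i => (hT i).isCompact_closure_image_closedBall r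
  obtain ⟨a, -, φ, hφ, hlim⟩ := hcomp.tendsto_subseq (x := fun k i => T i (ξ i k))
    fun k i _ => subset_closure ⟨ξ i k, by simpa using hξ i k, rfl⟩
  exact ⟨φ, hφ, a, tendsto_pi_nhds.mp hlim⟩

variable {A : Type uA} [NonUnitalCStarAlgebra A] [PartialOrder A]
variable {H : Type uH} [NormedAddCommGroup H] [InnerProductSpace ℂ H] [CompleteSpace H]
variable {V : Type*} [NormedAddCommGroup V] [NormedSpace ℂ V] [SMul Aᵐᵒᵖ V] [CStarModule Aᵐᵒᵖ V]
variable {W : Type*} [NormedAddCommGroup W] [NormedSpace ℂ W] [SMul Aᵐᵒᵖ W] [CStarModule Aᵐᵒᵖ W]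

/-- The image of the `A`-product of two module elements under a representation of `A`. -/
noncomputable def representedInner (π : A →⋆ₙₐ[ℂ] (H →L[ℂ] H)) (x y : W) : H →L[ℂ] H :=
  π (inner Aᵐᵒᵖ x y).unop

theorem representedInner_sub_right (π : A →⋆ₙₐ[ℂ] (H →L[ℂ] H)) (x y z : W) :
    representedInner π x (y - z) = representedInner π x y - representedInner π x z := by
  simp [representedInner]

theorem representedInner_sum_right_smul (π : A →⋆ₙₐ[ℂ] (H →L[ℂ] H)) {n : ℕ} (v : W)
    (x : Fin n → V) (y : Fin n → W) (z : V) :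
    representedInner π v (∑ i, y i <• (inner Aᵐᵒᵖ (x i) z).unop) =
      ∑ i, representedInner π v (y i) ∘L representedInner π (x i) z := by
  simp only [representedInner, CStarModule.inner_sum_right, CStarModule.inner_op_smul_right,
    Finset.unop_sum, MulOpposite.unop_mul, MulOpposite.unop_op, map_sum, map_mul]
  rfl

theorem norm_representedInner {π : A →⋆ₙₐ[ℂ] (H →L[ℂ] H)} (hπ : Function.Injective π) (x y : W) :
    ‖representedInner π x y‖ = ‖inner Aᵐᵒᵖ x y‖ :=
  NonUnitalStarAlgHom.norm_map π hπ _

variable [StarOrderedRing A]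

theorem norm_representedInner_le {π : A →⋆ₙₐ[ℂ] (H →L[ℂ] H)} (hπ : Function.Injective π)
    (x y : W) : ‖representedInner π x y‖ ≤ ‖x‖ * ‖y‖ :=
  (norm_representedInner hπ x y).trans_le (CStarModule.norm_inner_le W)

/-- Over a C*-algebra of compact operators, the adjoint of a morphism that is right invertible
modulo `A`-compact morphisms is bounded below on the closure of the range. -/
theorem IsAdjointMap.exists_bounded_below_of_comp_eq_id_add
    (hA : IsCStarAlgebraOfCompactOperators.{uA, uH} A) {F : V →L[ℂ] W} {F' : W →L[ℂ] V}
    (hF : IsAdjointMap A F F') {G : W →L[ℂ] V} {P : W →L[ℂ] W}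
    (hFG : F ∘L G = ContinuousLinearMap.id ℂ W + P) (hP : IsACompact A P) :
    ∃ c : ℝ, 0 < c ∧ ∀ w ∈ closure (Set.range F), c * ‖w‖ ≤ ‖F' w‖ := by
  obtain ⟨H, _, _, _, π, hπ, hcpt⟩ := hA
  by_contra! hcon
  have hw : ∀ k : ℕ, ∃ w ∈ closure (Set.range F), ‖w‖ = 1 ∧ ‖F' w‖ ≤ 1 / ((k : ℝ) + 1) := by
    intro k
    obtain ⟨w, hw, hlt⟩ := hcon (1 / ((k : ℝ) + 1)) (by positivity)
    have h0 : 0 < ‖w‖ := by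
      by_contra! h
      have : w = 0 := norm_le_zero_iff.mp h
      simp [this] at hlt
    refine ⟨(((‖w‖⁻¹ : ℝ)) : ℂ) • w, ?_, ?_, ?_⟩
    · exact (LinearMap.range (F : V →ₗ[ℂ] W)).topologicalClosure.smul_mem _ hw
    · rw [norm_smul, Complex.norm_real, Real.norm_of_nonneg (by positivity),
        inv_mul_cancel₀ h0.ne']
    · rw [map_smul, norm_smul, Complex.norm_real, Real.norm_of_nonneg (by positivity),
        inv_mul_le_iff₀ h0, mul_comm]
      exact hlt.le
  choose w hwY hw1 hwF using hw
  -- Squares are needed: the coefficients `(x i, w)` of `Q w` lie in `A`, and bounded sequences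
  -- there need not have convergent subsequences. In `Q²` they are preceded by `(x i, y j)`, which
  -- `π` makes compact.
  obtain ⟨Q, ⟨-, n, x, y, hQ⟩, hQP⟩ : ∃ Q, IsAFiniteRank A Q ∧ ‖P ∘L P - Q ∘L Q‖ < 1 / 64 := by
    have hcont : Continuous fun Q : W →L[ℂ] W => ‖P ∘L P - Q ∘L Q‖ := by fun_prop
    have hmem : {Q : W →L[ℂ] W | ‖P ∘L P - Q ∘L Q‖ < 1 / 64} ∈ nhds P :=
      (isOpen_lt hcont continuous_const).mem_nhds (by simp)
    obtain ⟨Q, hQ1, hQ2⟩ := mem_closure_iff_nhds.mp hP.2 _ hmem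
    exact ⟨Q, hQ2, hQ1⟩
  let ρ : W → W → H →L[ℂ] H := representedInner π
  have hh : ∀ k, ∃ h : H, ‖h‖ < 1 ∧ 1 / 2 < ‖ρ (w k) (w k) h‖ := fun k => by
    refine ContinuousLinearMap.exists_lt_apply_of_lt_opNorm _ ?_
    rw [norm_representedInner hπ, ← CStarModule.norm_sq_eq Aᵐᵒᵖ, hw1]
    norm_num
  choose h hh1 hh2 using hh
  let g : ℕ → H := fun k => ρ (w k) (w k) (h k)
  have hρ : ∀ (k l : ℕ) (v : W), ‖ρ (w k) v (h l)‖ ≤ ‖inner Aᵐᵒᵖ (w k) v‖ := fun k l v => by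
    rw [← norm_representedInner hπ]
    exact (ContinuousLinearMap.le_opNorm _ _).trans
      (mul_le_of_le_one_right (norm_nonneg _) (hh1 l).le)
  have hg : ∀ k, ‖g k‖ ≤ 1 := fun k => (hρ k k (w k)).trans (by
    rw [← CStarModule.norm_sq_eq Aᵐᵒᵖ, hw1, one_pow])
  have hgρ : ∀ (k l : ℕ) (v : W), ‖inner ℂ (g k) (ρ (w k) v (h l))‖ ≤ ‖inner Aᵐᵒᵖ (w k) v‖ :=
    fun k l v => (norm_inner_le_norm _ _).trans
      ((mul_le_of_le_one_left (norm_nonneg _) (hg k)).trans (hρ k l v))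
  have hdiag : ∀ k, 1 / 4 ≤ ‖inner ℂ (g k) (ρ (w k) (w k) (h k))‖ := fun k => by
    change 1 / 4 ≤ ‖inner ℂ (g k) (g k)‖
    rw [inner_self_eq_norm_sq_to_K]
    have h1 : 1 / 2 < ‖g k‖ := hh2 k
    simp only [norm_pow, RCLike.norm_ofReal, abs_norm]
    nlinarith
  obtain ⟨C, hC⟩ : ∃ C : ℝ, ∀ k l : ℕ,
      ‖inner Aᵐᵒᵖ (w k) (w l - Q (Q (w l)))‖ ≤ 1 / ((k : ℝ) + 1) * C + 1 / 64 := by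
    refine ⟨‖G‖ + ‖G‖ * ‖P‖, fun k l => ?_⟩
    have hid : ∀ z, F (G z) = z + P z := fun z => congrArg (fun f : W →L[ℂ] W => f z) hFG
    -- Since `F G = 1 + P`, the factorisation `1 - P² = (1 + P)(1 - P)` puts `w - P² w` in the range
    -- of `F`; pairing with `w k` then moves `F'` onto `w k`.
    have hsplit : w l - Q (Q (w l)) =
        F (G (w l) - G (P (w l))) + (P ∘L P - Q ∘L Q) (w l) := by
      rw [map_sub, hid, hid]
      simp only [sub_apply, ContinuousLinearMap.comp_apply]
      abel
    rw [hsplit, CStarModule.inner_add_right, ← hF.symm]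
    refine (norm_add_le _ _).trans (add_le_add ?_ ?_)
    · refine (CStarModule.norm_inner_le V).trans (mul_le_mul (hwF k) ?_ (norm_nonneg _)
        (by positivity))
      refine (norm_sub_le _ _).trans (add_le_add ?_ ?_)
      · simpa [hw1] using G.le_opNorm (w l)
      · refine (G.le_opNorm _).trans (mul_le_mul_of_nonneg_left ?_ (norm_nonneg _))
        simpa [hw1] using P.le_opNorm (w l)
    · refine (CStarModule.norm_inner_le W).trans ?_
      rw [hw1, one_mul]
      refine ((P ∘L P - Q ∘L Q).le_opNorm _).trans ?_
      rw [hw1, mul_one]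
      exact hQP.le
  obtain ⟨φ, hφ, a, ha⟩ := exists_strictMono_forall_tendsto
    (T := fun p : Fin n × Fin n => ρ (x p.1) (y p.2))
    (ξ := fun p k => ρ (x p.2) (w k) (h k)) (r := ∑ i, ‖x i‖) (fun p => hcpt _) (by
      rintro ⟨i, j⟩ k
      refine (ContinuousLinearMap.le_opNorm _ _).trans
        ((mul_le_of_le_one_right (norm_nonneg _) (hh1 k).le).trans ?_)
      refine (norm_representedInner_le hπ _ _).trans ?_
      rw [hw1, mul_one]
      exact Finset.single_le_sum (f := fun i => ‖x i‖) (fun _ _ => norm_nonneg _)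
        (Finset.mem_univ j))
  let η : Fin n → ℕ → H := fun i k => ρ (x i) (Q (w k)) (h k)
  have hη : ∀ i, Tendsto (fun k => η i (φ k)) atTop (nhds (∑ j, a (i, j))) := by
    intro i
    have h1 : (fun k => η i (φ k)) =
        fun k => ∑ j, ρ (x i) (y j) (ρ (x j) (w (φ k)) (h (φ k))) := by
      funext k
      simp only [η, ρ]
      rw [hQ, representedInner_sum_right_smul, sum_apply]
      rfl
    rw [h1]
    exact tendsto_finsetSum _ fun j _ => ha (i, j)
  have hQQ : ∀ k l, ρ (w k) (Q (Q (w l))) (h l) = ∑ i, ρ (w k) (y i) (η i l) := by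
    intro k l
    simp only [η, ρ]
    rw [hQ (Q (w l)), representedInner_sum_right_smul, sum_apply]
    rfl
  have hdiff : Tendsto (fun p : ℕ × ℕ => ∑ i, ‖y i‖ * ‖η i (φ p.2) - η i (φ p.1)‖) atTop
      (nhds 0) := by
    have h1 : Tendsto (fun p : ℕ × ℕ => ∑ i, ‖y i‖ * ‖η i (φ p.2) - η i (φ p.1)‖) atTop
        (nhds (∑ i, ‖y i‖ * ‖∑ j, a (i, j) - ∑ j, a (i, j)‖)) := by
      rw [← prod_atTop_atTop_eq]
      exact tendsto_finsetSum _ fun i _ =>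
        (((hη i).comp tendsto_snd).sub ((hη i).comp tendsto_fst)).norm.const_mul _
    simpa using h1
  obtain ⟨N, hN⟩ := eventually_atTop_prod_self.mp
    (hdiff.eventually_le_const (by norm_num : (0 : ℝ) < 1 / 64))
  have hsmall : ∀ r : ℝ, ∃ M : ℕ, ∀ k ≥ M, 1 / ((k : ℝ) + 1) * r ≤ 1 / 64 := by
    intro r
    have h1 := (tendsto_one_div_add_atTop_nhds_zero_nat (𝕜 := ℝ)).mul_const r
    rw [zero_mul] at h1
    exact eventually_atTop.mp (h1.eventually_le_const (by norm_num))
  obtain ⟨M, hM⟩ := hsmall C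
  let m := max N M
  -- The order of choices matters: `m` and the approximant `F z` of `w (φ m)` are fixed first, then
  -- `k` is taken large depending on `‖z‖`.
  obtain ⟨-, ⟨z, rfl⟩, hz⟩ := Metric.mem_closure_iff.mp (hwY (φ m)) (1 / 64) (by norm_num)
  obtain ⟨M', hM'⟩ := hsmall ‖z‖
  let k := max m M'
  have hNm : N ≤ m := le_max_left _ _
  have hmk : m ≤ k := le_max_left _ _
  have hMk : M ≤ φ k := ((le_max_right N M).trans hmk).trans hφ.le_apply
  have hMk' : M' ≤ φ k := (le_max_right m M').trans hφ.le_apply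
  have hB : ∀ l, ‖inner ℂ (g (φ k)) (ρ (w (φ k)) (w l) (h l))
      - inner ℂ (g (φ k)) (ρ (w (φ k)) (Q (Q (w l))) (h l))‖ ≤ 1 / 32 := by
    intro l
    have h1 := hgρ (φ k) l (w l - Q (Q (w l)))
    simp only [ρ] at h1 ⊢
    rw [representedInner_sub_right, sub_apply, inner_sub_right] at h1
    linarith [hC (φ k) l, hM _ hMk]
  have hQB : ‖inner ℂ (g (φ k)) (ρ (w (φ k)) (Q (Q (w (φ m)))) (h (φ m)))
      - inner ℂ (g (φ k)) (ρ (w (φ k)) (Q (Q (w (φ k)))) (h (φ k)))‖ ≤ 1 / 64 := by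
    rw [hQQ, hQQ, ← inner_sub_right, ← Finset.sum_sub_distrib]
    simp only [← map_sub]
    refine (norm_inner_le_norm _ _).trans ((mul_le_of_le_one_left (norm_nonneg _) (hg _)).trans ?_)
    refine (norm_sum_le _ _).trans (le_trans (Finset.sum_le_sum fun i _ => ?_)
      (hN k m (hNm.trans hmk) hNm))
    refine (ContinuousLinearMap.le_opNorm _ _).trans
      (mul_le_mul_of_nonneg_right ?_ (norm_nonneg _))
    simpa [hw1] using norm_representedInner_le hπ (w (φ k)) (y i)
  have hzero : ‖inner ℂ (g (φ k)) (ρ (w (φ k)) (w (φ m)) (h (φ m)))‖ ≤ 1 / 32 := by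
    refine (hgρ _ _ _).trans ?_
    have h1 : w (φ m) = F z + (w (φ m) - F z) := by abel
    rw [h1, CStarModule.inner_add_right, ← hF.symm]
    have h2 : ‖inner Aᵐᵒᵖ (F' (w (φ k))) z‖ ≤ 1 / ((φ k : ℝ) + 1) * ‖z‖ :=
      (CStarModule.norm_inner_le V).trans (mul_le_mul_of_nonneg_right (hwF _) (norm_nonneg _))
    have h3 : ‖inner Aᵐᵒᵖ (w (φ k)) (w (φ m) - F z)‖ ≤ 1 / 64 := by
      refine (CStarModule.norm_inner_le W).trans ?_
      rw [hw1, one_mul, ← dist_eq_norm]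
      exact hz.le
    refine (norm_add_le _ _).trans ?_
    linarith [hM' _ hMk']
  have e1 := hB (φ m)
  have e2 := hB (φ k)
  have e3 := hdiag (φ k)
  generalize inner ℂ (g (φ k)) (ρ (w (φ k)) (w (φ m)) (h (φ m))) = b₁ at *
  generalize inner ℂ (g (φ k)) (ρ (w (φ k)) (w (φ k)) (h (φ k))) = b₂ at *
  generalize inner ℂ (g (φ k)) (ρ (w (φ k)) (Q (Q (w (φ m)))) (h (φ m))) = b₃ at *
  generalize inner ℂ (g (φ k)) (ρ (w (φ k)) (Q (Q (w (φ k)))) (h (φ k))) = b₄ at *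
  -- The errors add up to at most `7/64`, against the diagonal lower bound `1/4`.
  have e4 : b₂ = b₁ - (b₁ - b₃) - (b₃ - b₄) + (b₂ - b₄) := by ring
  have e5 : ‖b₂‖ ≤ ‖b₁‖ + ‖b₁ - b₃‖ + ‖b₃ - b₄‖ + ‖b₂ - b₄‖ := by
    conv_lhs => rw [e4]
    exact (norm_add_le _ _).trans (add_le_add_left ((norm_sub_le _ _).trans
      (add_le_add_left (norm_sub_le _ _) _)) _)
  linarith

end Compactness

/-! ### Splittings and the construction of the parametrix -/

section Decomposition

open scoped RightActions
open CStarModule (inner_self inner_self_nonneg star_inner norm_sq_eq norm_inner_le)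

variable {A : Type uA} [NonUnitalCStarAlgebra A] [PartialOrder A] [StarOrderedRing A]
variable {V : Type*} [NormedAddCommGroup V] [NormedSpace ℂ V] [SMul Aᵐᵒᵖ V] [CStarModule Aᵐᵒᵖ V]
variable {W : Type*} [NormedAddCommGroup W] [NormedSpace ℂ W] [SMul Aᵐᵒᵖ W] [CStarModule Aᵐᵒᵖ W]
variable {U : Type*} [NormedAddCommGroup U] [NormedSpace ℂ U] [SMul Aᵐᵒᵖ U] [CStarModule Aᵐᵒᵖ U]

local notation "⟪" x ", " y "⟫" => inner Aᵐᵒᵖ x y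

/-- If the adjoint of a morphism is bounded below on the closure of the range, then the range and
the kernel of the adjoint span the target, and the morphism is open onto its range. -/
theorem IsAdjointMap.exists_decomposition [CompleteSpace W] {F : V →L[ℂ] W} {F' : W →L[ℂ] V}
    (hF : IsAdjointMap A F F') {c : ℝ} (hc : 0 < c)
    (hb : ∀ w ∈ closure (Set.range F), c * ‖w‖ ≤ ‖F' w‖) :
    (∀ w, ∃ v, F' (w - F v) = 0) ∧ ∃ C : ℝ, ∀ v, ∃ v', F v' = F v ∧ ‖v'‖ ≤ C * ‖F v‖ := by
  let Y : Submodule ℂ W := (LinearMap.range (F : V →ₗ[ℂ] W)).topologicalClosure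
  have hFY : ∀ v, F v ∈ Y := fun v => subset_closure ⟨v, rfl⟩
  have : CompleteSpace Y :=
    (LinearMap.range (F : V →ₗ[ℂ] W)).isClosed_topologicalClosure.completeSpace_coe
  let S : W →L[ℂ] W := F ∘L F'
  have hS : IsAdjointMap A S S := fun u w => (hF _ _).trans (hF.symm _ _)
  have hSb : ∀ w ∈ Y, c ^ 2 * ‖w‖ ≤ ‖S w‖ := by
    intro w hw
    rcases (norm_nonneg w).eq_or_lt with h0 | h0
    · rw [← h0, mul_zero]; exact norm_nonneg _
    refine le_of_mul_le_mul_right ?_ h0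
    calc c ^ 2 * ‖w‖ * ‖w‖ = (c * ‖w‖) ^ 2 := by ring
      _ ≤ ‖F' w‖ ^ 2 := by gcongr; exact hb w hw
      _ = ‖⟪S w, w⟫‖ := by rw [norm_sq_eq Aᵐᵒᵖ, ← hF]; rfl
      _ ≤ ‖S w‖ * ‖w‖ := norm_inner_le W
  have hsurj := hS.exists_apply_eq_of_bounded_below Y (fun y _ => hFY _) (by positivity) hSb
  refine ⟨fun w => ?_, ‖F'‖ * (c ^ 2)⁻¹, fun v => ?_⟩
  · obtain ⟨y, hy, hyw⟩ := hsurj (S w) (hFY _)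
    -- Solving a second time writes `y` as `F (F' z)`, an element of the range and not merely of its
    -- closure.
    obtain ⟨z, -, rfl⟩ := hsurj y hy
    refine ⟨F' z, ?_⟩
    have h0 : F (F' (w - F (F' z))) = 0 := by
      rw [map_sub, map_sub, sub_eq_zero]
      exact hyw.symm
    rw [← inner_self (A := Aᵐᵒᵖ), hF.symm, h0, CStarModule.inner_zero_right]
  · obtain ⟨y, hy, hyv⟩ := hsurj (F v) (hFY v)
    refine ⟨F' y, hyv, (F'.le_opNorm y).trans ?_⟩
    rw [mul_assoc]
    gcongr
    rw [inv_mul_eq_div, le_div_iff₀ (by positivity), mul_comm, ← hyv]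
    exact hSb y hy

/-- If `‖s • D x‖ ≤ ‖l + s • D x‖` for all real `s` and all `x`, where `D` is self-adjoint, then
`D l = 0`. -/
theorem IsAdjointMap.apply_eq_zero_of_norm_smul_le {D : U →L[ℂ] U} (hD : IsAdjointMap A D D) {l : U}
    (hl : ∀ (s : ℝ) (x : U), ‖(s : ℂ) • D x‖ ≤ ‖l + (s : ℂ) • D x‖) : D l = 0 := by
  have hinj : ∀ x, D (D x) = 0 → D x = 0 := fun x hx => by
    rw [← inner_self (A := Aᵐᵒᵖ), hD, hx, CStarModule.inner_zero_right]
  refine hinj l ?_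
  set e := D l
  set a := ⟪e, e⟫
  set b := ⟪D e, D e⟫
  set d := ⟪D (D e), D (D e)⟫
  have hbe : b = ⟪e, D (D e)⟫ := hD _ _
  have hbe' : b = ⟪D (D e), e⟫ := (hD _ _).symm
  have ha : ⟪l, D e⟫ = a := (hD _ _).symm
  have ha' : ⟪D e, l⟫ = a := hD _ _
  -- For scalars, expanding `‖l - s • D e‖²` would bound `2 s ‖e‖²` by `‖l‖²` at once. For
  -- `A`-valued squares the term `-2 s a` cannot be split off the norm, so `a` is bounded below by
  -- `2 δ b - δ² d` and absorbed into `s² b`; `4 δ ≤ s` keeps the resulting coefficient nonnegative.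
  have key : ∀ δ s : ℝ, 0 < δ → 4 * δ ≤ s → 4 * s * δ * ‖b‖ ≤ ‖l‖ ^ 2 + 2 * s * δ ^ 2 * ‖d‖ := by
    intro δ s hδ hs
    have hs0 : 0 < s := by linarith
    have h1 : (2 * δ) • b ≤ a + (δ ^ 2) • d := by
      have h2 : (0 : Aᵐᵒᵖ) ≤ ⟪e - δ • D (D e), e - δ • D (D e)⟫ := inner_self_nonneg
      have h3 : ⟪e - δ • D (D e), e - δ • D (D e)⟫ = a + (δ ^ 2) • d - (2 * δ) • b := by
        simp only [CStarModule.inner_sub_left, CStarModule.inner_sub_right,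
          CStarModule.inner_smul_left_real, CStarModule.inner_smul_right_real, ← hbe, ← hbe', a, d]
        module
      rwa [h3, sub_nonneg] at h2
    have h4 : ⟪l - s • D e, l - s • D e⟫ = ⟪l, l⟫ - (2 * s) • a + (s ^ 2) • b := by
      simp only [CStarModule.inner_sub_left, CStarModule.inner_sub_right,
        CStarModule.inner_smul_left_real, CStarModule.inner_smul_right_real, ha, ha', b]
      module
    have h5 : ⟪l - s • D e, l - s • D e⟫ ≤
        ⟪l, l⟫ + (s ^ 2 - 4 * s * δ) • b + (2 * s * δ ^ 2) • d := by
      rw [h4]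
      have h6 := smul_le_smul_of_nonneg_left h1 (by positivity : (0 : ℝ) ≤ 2 * s)
      have h7 : ⟪l, l⟫ + (s ^ 2 - 4 * s * δ) • b + (2 * s * δ ^ 2) • d =
        ⟪l, l⟫ - (2 * s) • a + (s ^ 2) • b +
          ((2 * s) • (a + (δ ^ 2) • d) - (2 * s) • (2 * δ) • b) := by module
      rw [h7]
      exact le_add_of_nonneg_right (sub_nonneg.mpr h6)
    have h8 : s ^ 2 * ‖b‖ ≤ ‖⟪l - s • D e, l - s • D e⟫‖ := by
      have h9 := hl (-s) e
      rw [Complex.coe_smul, neg_smul, ← sub_eq_add_neg, norm_neg, norm_smul,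
        Real.norm_of_nonneg hs0.le] at h9
      rw [← norm_sq_eq Aᵐᵒᵖ, ← norm_sq_eq Aᵐᵒᵖ, ← mul_pow]
      gcongr
    have h10 := h8.trans (CStarAlgebra.norm_le_norm_of_nonneg_of_le inner_self_nonneg h5)
    have h11 : ‖⟪l, l⟫ + (s ^ 2 - 4 * s * δ) • b + (2 * s * δ ^ 2) • d‖ ≤
        ‖l‖ ^ 2 + (s ^ 2 - 4 * s * δ) * ‖b‖ + 2 * s * δ ^ 2 * ‖d‖ := by
      refine norm_add₃_le.trans (le_of_eq ?_)
      rw [norm_smul, norm_smul, ← norm_sq_eq Aᵐᵒᵖ, Real.norm_of_nonneg (by nlinarith),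
        Real.norm_of_nonneg (by positivity)]
    nlinarith [h10.trans h11]
  -- Letting `s → ∞` removes `‖l‖²`; letting `δ → 0` afterwards gives `b = 0`.
  have hb2 : ∀ δ : ℝ, 0 < δ → 2 * ‖b‖ ≤ δ * ‖d‖ := by
    intro δ hδ
    by_contra! hlt
    have hg : 0 < 2 * δ * (2 * ‖b‖ - δ * ‖d‖) := mul_pos (by positivity) (by linarith)
    set s := max (4 * δ) ((‖l‖ ^ 2 + 1) / (2 * δ * (2 * ‖b‖ - δ * ‖d‖)))
    have h1 := key δ s hδ (le_max_left _ _)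
    have h2 := (div_le_iff₀ hg).mp (le_max_right (4 * δ) ((‖l‖ ^ 2 + 1) / _))
    change _ ≤ s * _ at h2
    linarith
  have hb0 : ‖b‖ ≤ 0 := by
    by_contra! hlt
    have h1 := hb2 (‖b‖ / (‖d‖ + 1)) (by positivity)
    have h2 : ‖b‖ / (‖d‖ + 1) * ‖d‖ ≤ ‖b‖ := by
      rw [div_mul_eq_mul_div, div_le_iff₀ (by positivity)]
      nlinarith [norm_nonneg d]
    linarith
  exact inner_self.mp (norm_le_zero_iff.mp hb0)

/-- A self-adjoint operator `D` whose kernel and range span the space, and which is open onto its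
range, possesses a self-adjoint parametrix. -/
theorem IsAdjointMap.isSelfAdjointParametrixPossessing {D : U →L[ℂ] U} (hD : IsAdjointMap A D D)
    (hspan : ∀ u, ∃ x, D (u - D x) = 0) {C : ℝ}
    (hopen : ∀ u, ∃ u', D u' = D u ∧ ‖u'‖ ≤ C * ‖D u‖) :
    IsSelfAdjointParametrixPossessing A D := by
  have horth : ∀ {k : U}, D k = 0 → ∀ x, ⟪k, D x⟫ = 0 := fun {k} hk x => by
    rw [← hD, hk, CStarModule.inner_zero_left]
  have hinj : ∀ x, D (D x) = 0 → D x = 0 := fun x hx => by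
    rw [← inner_self (A := Aᵐᵒᵖ), hD, hx, CStarModule.inner_zero_right]
  choose r hr using hspan
  -- The choice `r` need not be linear, but `D (r u)` is canonical because `D` is injective on its
  -- range.
  have hr_unique : ∀ {u x : U}, D (u - D x) = 0 → D (r u) = D x := fun {u x} hx => by
    rw [← sub_eq_zero, ← map_sub]
    refine hinj _ ?_
    have h1 : D (r u - x) = (u - D x) - (u - D (r u)) := by rw [map_sub]; abel
    rw [h1, map_sub, hx, hr, sub_zero]
  let P : U → U := fun u => u - D (r u)
  have hDP : ∀ u, D (P u) = 0 := hr
  have hPP : ∀ u v, ⟪P u, v⟫ = ⟪P u, P v⟫ := fun u v => by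
    change _ = ⟪P u, v - D (r v)⟫
    rw [CStarModule.inner_sub_right, horth (hDP u), sub_zero]
  have hP : IsAdjointMap A P P := fun u v => by
    rw [hPP, ← star_inner, ← hPP, star_inner]
  have hPn : ∀ u, ‖P u‖ ≤ ‖u‖ := fun u => by
    have h1 : ⟪D (r u), P u⟫ = 0 := by rw [← star_inner, horth (hDP u), star_zero]
    have h2 := norm_le_norm_add_of_inner_eq_zero A h1
    rwa [show D (r u) + P u = u from add_sub_cancel _ _] at h2
  -- Applying `r` twice selects the preimage of `D (r u)` that lies in the range of `D`.
  let G : U → U := fun u => D (r (r u))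
  have hDG : ∀ u, D (G u) = D (r u) := fun u => by
    have h1 := hr (r u)
    rw [map_sub, sub_eq_zero] at h1
    exact h1.symm
  have hG_unique : ∀ {u x : U}, D (u - D (D x)) = 0 → G u = D x := fun {u x} hx => by
    refine (sub_eq_zero.mp ?_)
    rw [← map_sub]
    refine hinj _ ?_
    rw [map_sub, map_sub, sub_eq_zero]
    exact (hDG u).trans (hr_unique hx)
  have hG : IsAdjointMap A G G := fun u v => by
    have hsplit : ∀ w : U, w = D (G w) + P w := fun w => by
      rw [hDG]; exact (add_sub_cancel _ _).symm
    have h1 : ⟪G u, v⟫ = ⟪G u, D (G v)⟫ := by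
      conv_lhs => rw [hsplit v]
      rw [CStarModule.inner_add_right, ← star_inner (P v), horth (hDP v), star_zero, add_zero]
    have h2 : ⟪u, G v⟫ = ⟪D (G u), G v⟫ := by
      conv_lhs => rw [hsplit u]
      rw [CStarModule.inner_add_left, horth (hDP u), add_zero]
    exact h1.trans ((hD _ _).symm.trans h2.symm)
  have hGn : ∀ u, ‖G u‖ ≤ 2 * |C| * ‖u‖ := fun u => by
    -- `G u` is the range component of any preimage of `D (G u)`, so it is no longer than the
    -- preimage with controlled norm.
    obtain ⟨u', hu', hn⟩ := hopen (G u)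
    have h1 : G u = u' - P u' := by
      have h2 : D (r u') = G u := by
        refine hr_unique ?_
        rw [map_sub, hu', sub_eq_zero]
      rw [← h2]
      exact (sub_sub_cancel _ _).symm
    have h3 : ‖G u‖ ≤ ‖u'‖ := by
      have h4 : ⟪P u', G u⟫ = 0 := horth (hDP u') _
      have h5 := norm_le_norm_add_of_inner_eq_zero A h4
      rw [show P u' + G u = u' by rw [h1]; exact add_sub_cancel _ _] at h5
      exact h5
    have h6 : ‖D (G u)‖ ≤ 2 * ‖u‖ := by
      rw [hDG, show D (r u) = u - P u from (sub_sub_cancel _ _).symm]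
      linarith [norm_sub_le u (P u), hPn u]
    calc ‖G u‖ ≤ C * ‖D (G u)‖ := h3.trans hn
      _ ≤ |C| * (2 * ‖u‖) := mul_le_mul (le_abs_self C) h6 (norm_nonneg _) (abs_nonneg _)
      _ = 2 * |C| * ‖u‖ := by ring
  obtain ⟨Pc, hPc⟩ := hP.exists_continuousLinearMap_of_norm_le (C := 1) (by simpa using hPn)
  obtain ⟨Gc, hGc⟩ := hG.exists_continuousLinearMap_of_norm_le hGn
  rw [← hPc] at hP
  rw [← hGc] at hG
  refine ⟨hD.isModuleMorphism, hD, Gc, Pc, hG.isModuleMorphism, hP.isModuleMorphism, hP,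
    ?_, ?_, ?_⟩
  · ext u
    change u = Gc (D u) + Pc u
    rw [hGc, hPc]
    have h1 : G (D u) = D (r u) := hG_unique (by
      have h2 := hr u
      rw [map_sub, sub_eq_zero] at h2
      rw [← h2, sub_self, map_zero])
    rw [h1]
    exact (add_sub_cancel _ _).symm
  · ext u
    change u = D (Gc u) + Pc u
    rw [hGc, hPc, hDG]
    exact (add_sub_cancel _ _).symm
  · ext u
    change D (Pc u) = 0
    rw [hPc]
    exact hDP u

end Decomposition

/-! ### Descent from `V` and `W` to `U` -/

theorem theorem6
    {A : Type uA} [NonUnitalCStarAlgebra A] [PartialOrder A] [StarOrderedRing A]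
    (hA : IsCStarAlgebraOfCompactOperators.{uA, uH} A)
    -- the Hilbert `A`-modules `V` and `W`
    {V : Type*} [NormedAddCommGroup V] [NormedSpace ℂ V] [SMul Aᵐᵒᵖ V] [CStarModule Aᵐᵒᵖ V]
    [CompleteSpace V]
    {W : Type*} [NormedAddCommGroup W] [NormedSpace ℂ W] [SMul Aᵐᵒᵖ W] [CStarModule Aᵐᵒᵖ W]
    [CompleteSpace W]
    -- the pre-Hilbert `A`-module `U`, a vector subspace of `V` and of `W`
    {U : Type*} [NormedAddCommGroup U] [NormedSpace ℂ U] [SMul Aᵐᵒᵖ U] [CStarModule Aᵐᵒᵖ U]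
    (jV : U →ₗ[ℂ] V) (hjV : Function.Injective jV)
    (jW : U →ₗ[ℂ] W) (hjW : Function.Injective jW)
    -- the norms of `W` and `U` coincide on `U`, and the norm of `V` dominates that of `U`
    (hnormW : ∀ u : U, ‖jW u‖ = ‖u‖)
    (hnormV : ∃ C : ℝ, ∀ u : U, ‖u‖ ≤ C * ‖jV u‖)
    -- a self-adjoint morphism `D` of `U`
    (D : U →L[ℂ] U) (hD : IsModuleMorphism A D) (hDsa : IsAdjointMap A D D)
    -- an adjointable extension `Dt : V → W` of `D`, with adjoint `Dts : W → V`
    (Dt : V →L[ℂ] W) (hDt : IsModuleMorphism A Dt)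
    (Dts : W → V) (hDts : IsAdjointMap A Dt Dts)
    (hext : ∀ u : U, Dt (jV u) = jW (D u))
    (hFredholm : IsAFredholm A Dt)
    (hreg : Dt ⁻¹' Set.range jW ⊆ Set.range jV)
    (hreg' : Dts ⁻¹' Set.range jV ⊆ Set.range jW)
    (hker : {v : V | Dt v = 0} ⊆ Set.range jV)
    (hker' : {w : W | Dts w = 0} ⊆ Set.range jW) :
    IsSelfAdjointParametrixPossessing A D := by
  obtain ⟨Dta, rfl⟩ := hDts.exists_continuousLinearMap
  obtain ⟨-, -, G, P, -, hP, hFG⟩ := hFredholm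
  obtain ⟨c, hc, hb⟩ := hDts.exists_bounded_below_of_comp_eq_id_add hA hFG hP
  obtain ⟨hdec, C, hC⟩ := hDts.exists_decomposition hc hb
  obtain ⟨C', hC'⟩ := hnormV
  refine hDsa.isSelfAdjointParametrixPossessing (C := |C'| * C) (fun u => ?_) fun u => ?_
  · obtain ⟨v, hv⟩ := hdec (jW u)
    obtain ⟨l, hl⟩ := hker' hv
    obtain ⟨x, rfl⟩ : v ∈ Set.range jV :=
      hreg ⟨u - l, by rw [map_sub, hl, sub_sub_cancel]⟩
    have hlu : l = u - D x := hjW (by rw [hl, map_sub, hext])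
    refine ⟨x, ?_⟩
    rw [← hlu]
    -- In `W`, `jW l` lies in the kernel of the adjoint and is orthogonal to the range; the
    -- resulting norm inequality is what survives in `U`.
    refine hDsa.apply_eq_zero_of_norm_smul_le fun s y => ?_
    rw [← hnormW, ← hnormW (l + _), map_add, map_smul, ← hext]
    refine norm_le_norm_add_of_inner_eq_zero A ?_
    rw [CStarModule.inner_smul_right_complex, ← hDts.symm, hl, hv, CStarModule.inner_zero_left,
      smul_zero]
  · obtain ⟨v, hv, hvn⟩ := hC (jV u)
    -- The controlled preimage `v` differs from `jV u` by a kernel element, hence lies in `U` as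
    -- well.
    obtain ⟨k, hk⟩ : jV u - v ∈ Set.range jV := hker (by
      change Dt (jV u - v) = 0
      rw [map_sub, hv, sub_self])
    have hDk : D k = 0 := hjW (by rw [← hext, hk, map_sub, hv, sub_self, map_zero])
    refine ⟨u - k, by rw [map_sub, hDk, sub_zero], (hC' _).trans ?_⟩
    have h1 : jV (u - k) = v := by rw [map_sub, hk, sub_sub_cancel]
    rw [h1, mul_assoc]
    refine mul_le_mul (le_abs_self C') ?_ (norm_nonneg _) (abs_nonneg _)
    rwa [hext, hnormW] at hvn
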